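/- Let $p$ be a prime. For an abelian pro-$p$ group $G$, write $t(G)$ for its subgroup of torsion elements and define the torsion series of $G$ by transfinite recursion: $T_0(G)=0$; $T_{\alpha+1}(G)$ is the closed subgroup containing $T_\alpha(G)$ with $T_{\alpha+1}(G)/T_\alpha(G)=\overline{t(G/T_\alpha(G))}$; and $T_\delta(G)=\overline{\langle T_\alpha(G):\alpha<\delta\rangle}$ for limit ordinals $\delta$. The torsion type of $G$ is the least ordinal $\tau$ with $T_\tau(G)=T_{\tau+1}(G)$. We say that $G$ has torsion sequence $(N_\alpha)_{\alpha<\tau}$ if its torsion type is $\tau$ and $T_{\alpha+1}(G)/T_\alpha(G)\cong N_\alpha$ as topological groups for every $\alpha<\tau$. A profinite group is dual-reduced if it has no non-trivial torsion-free quotient by a closed normal subgroup. An abelian pro-$p$ group is Cartesian if it is topologically isomorphic to an unrestricted product of (finite) cyclic $p$-groups. A topological group is countably based if the identity has a countable basis of neighbourhoods. Theorem. Let $\tau$ be a countable ordinal and, for each $\alpha<\tau$, let $N_\alpha$ be a non-trivial countably based Cartesian abelian pro-$p$ group, such that $N_\alpha$ has unbounded exponent whenever $\alpha+1<\tau$.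 Then there exists a dual-reduced abelian pro-$p$ group $G$ with torsion sequence $(N_\alpha)_{\alpha<\tau}$. -/

import Mathlib

universe u v

/-- An abelian pro-`p` group: a compact, Hausdorff, totally disconnected abelian topological group
in which every open subgroup has index a power of `p`. -/
structure IsAbelianProP (p : ℕ) (G : Type u) [AddCommGroup G] [TopologicalSpace G] : Prop where
  isTopologicalAddGroup : IsTopologicalAddGroup G
  compactSpace : CompactSpace G
  t2Space : T2Space G
  totallyDisconnectedSpace : TotallyDisconnectedSpace G
  index_eq_pow : ∀ U : AddSubgroup G, IsOpen (U : Set G) → ∃ n : ℕ, U.index = p ^ n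

/-- A topological abelian group is Cartesian (for the prime `p`) if it is topologically isomorphic
to an unrestricted product, with the product topology, of a family of (finite, discrete) cyclic
`p`-groups. -/
def IsCartesian (p : ℕ) (N : Type u) [AddCommGroup N] [TopologicalSpace N] : Prop :=
  ∃ (ι : Type u) (k : ι → ℕ), Nonempty (N ≃ₜ+ ((i : ι) → ZMod (p ^ k i)))

/-- Dual-reduced: every torsion-free quotient by a closed subgroup is trivial. -/
def IsDualReduced (G : Type u) [AddCommGroup G] [TopologicalSpace G] : Prop :=
  ∀ H : AddSubgroup G, IsClosed (H : Set G) → IsAddTorsionFree (G ⧸ H) → Subsingleton (G ⧸ H)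

section TorsionSeries

variable (G : Type u) [AddCommGroup G] [TopologicalSpace G] [IsTopologicalAddGroup G]

/-- The closure of the subgroup of elements of finite order. -/
def closedTorsion : AddSubgroup G :=
  (AddCommGroup.torsion G).topologicalClosure

/-- The torsion series: `T 0` is trivial, `T (α + 1)` is the preimage in `G` of the closure of the
torsion of `G / T α`, and at a limit ordinal `δ`, `T δ` is the closure of the subgroup generated
by the `T α` with `α < δ`. -/
noncomputable def torsionSeries (α : Ordinal.{v}) : AddSubgroup G :=
  Ordinal.limitRecOn (motive := fun _ => AddSubgroup G) α
    ⊥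
    (fun _ T => (closedTorsion (G ⧸ T)).comap (QuotientAddGroup.mk' T))
    (fun δ _ T => (⨆ (β : Ordinal.{v}) (h : β < δ), T β h).topologicalClosure)

theorem torsionSeries_zero : torsionSeries G (0 : Ordinal.{v}) = ⊥ :=
  Ordinal.limitRecOn_zero _ _ _

theorem torsionSeries_add_one (α : Ordinal.{v}) :
    torsionSeries G (α + 1) =
      (closedTorsion (G ⧸ torsionSeries G α)).comap
        (QuotientAddGroup.mk' (torsionSeries G α)) :=
  Ordinal.limitRecOn_add_one _ _ _ _

theorem torsionSeries_limit (δ : Ordinal.{v}) (h : Order.IsSuccLimit δ) :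
    torsionSeries G δ =
      (⨆ (β : Ordinal.{v}) (_ : β < δ), torsionSeries G β).topologicalClosure :=
  Ordinal.limitRecOn_limit _ _ _ _ h

theorem torsionSeries_le_add_one (α : Ordinal.{v}) :
    torsionSeries G α ≤ torsionSeries G (α + 1) := by
  intro x hx
  rw [torsionSeries_add_one, AddSubgroup.mem_comap, QuotientAddGroup.mk'_apply,
    (QuotientAddGroup.eq_zero_iff x).2 hx]
  exact zero_mem _

/-- `τ` is the torsion type of `G`: the least ordinal with `T τ = T (τ + 1)`. -/
def IsTorsionType (τ : Ordinal.{v}) : Prop :=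
  IsLeast {σ : Ordinal.{v} | torsionSeries G σ = torsionSeries G (σ + 1)} τ

/-- The `α`-th term `T (α + 1) / T α` of the torsion sequence, with the quotient topology of the
subspace topology on `T (α + 1)`. -/
abbrev TorsionFactor (α : Ordinal.{v}) : Type u :=
  torsionSeries G (α + 1) ⧸ (torsionSeries G α).addSubgroupOf (torsionSeries G (α + 1))

/-- `G` has torsion sequence `(N α)` for `α < τ`: the torsion type of `G` is `τ`, and for every
`α < τ` the `α`-th term of the torsion sequence of `G` is topologically isomorphic to `N α`. -/
def HasTorsionSequence (τ : Ordinal.{v}) (N : Set.Iio τ → Type u)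
    [∀ α, AddCommGroup (N α)] [∀ α, TopologicalSpace (N α)] : Prop :=
  IsTorsionType G τ ∧ ∀ α : Set.Iio τ, Nonempty (TorsionFactor G α.1 ≃ₜ+ N α)

end TorsionSeries

/-! This is the dual of Zippin's theorem on Ulm sequences. Each non-trivial cyclic factor of `N α`
becomes a node of level `α`, and the nodes are arranged in a forest whose parents have strictly
higher level. `G` consists of the families in `∏ c, ZMod (p ^ depth c)` compatible with reduction
from node to parent, where `depth` adds the lengths along the path to the root. The claim is that `T
α` is the subgroup of families vanishing at all levels `≥ α` (`torsionSeries_dual`).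

Two facts carry the successor step. If `n • h` vanishes at levels `≥ α`, then at a node of level `>
α` a sufficiently long child of level `α` forces `h` to vanish (`mem_filtration_add_one`).
Conversely, cutting a family off outside a finite parent-closed set makes it torsion modulo the
previous term, whence density (`filtration_add_one_le_closure`). In the factor `T (α + 1) / T α`
only coordinates of level `α` survive; they are independent, and each ranges over the kernel of
reduction to its parent, cyclic of order `p ^ len c`.

The forest exists because countably many demands for children each have infinitely many candidates,
by unbounded exponent below the top level. -/

open Topology

/-! ### Reduction between the groups `ZMod (p ^ k)` -/

/-- Reduction `ZMod (p ^ b) → ZMod (p ^ a)` for `a ≤ b`. -/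
def ZMod.powReduction (p : ℕ) {a b : ℕ} (h : a ≤ b) : ZMod (p ^ b) →+* ZMod (p ^ a) :=
  ZMod.castHom (pow_dvd_pow p h) _

theorem ZMod.powReduction_eq_zero_iff (p : ℕ) [Fact p.Prime] {a b : ℕ} (h : a ≤ b)
    (x : ZMod (p ^ b)) : ZMod.powReduction p h x = 0 ↔ p ^ a ∣ x.val := by
  conv_lhs => rw [← ZMod.natCast_zmod_val x, map_natCast]
  exact ZMod.natCast_eq_zero_iff _ _

/-- Multiplication by `p ^ m` embeds `ZMod (p ^ k)` in `ZMod (p ^ (k + m))`. -/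
theorem ZMod.exists_pow_embedding (p : ℕ) [Fact p.Prime] {k m b : ℕ} (hb : b = k + m) :
    ∃ f : ZMod (p ^ k) →+ ZMod (p ^ b), Function.Injective f ∧
      ∀ x : ZMod (p ^ b), p ^ m ∣ x.val ↔ ∃ y, f y = x := by
  subst hb
  have hp : p ≠ 0 := (Fact.out : p.Prime).ne_zero
  let f₀ : ℤ →+ ZMod (p ^ (k + m)) :=
    (AddMonoidHom.mulLeft ((p ^ m : ℕ) : ZMod (p ^ (k + m)))).comp (Int.castAddHom _)
  have hf₀ : f₀ ((p ^ k : ℕ) : ℤ) = 0 := by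
    simp only [f₀, AddMonoidHom.comp_apply, AddMonoidHom.coe_mulLeft, Int.coe_castAddHom,
      Int.cast_natCast]
    rw [← Nat.cast_mul, ← pow_add, add_comm m k, ZMod.natCast_self]
  have hf : ∀ n : ℕ, ZMod.lift (p ^ k) ⟨f₀, hf₀⟩ (n : ZMod (p ^ k)) =
      ((p ^ m * n : ℕ) : ZMod (p ^ (k + m))) := by
    intro n
    have := ZMod.lift_coe (p ^ k) (⟨f₀, hf₀⟩ : { f : ℤ →+ ZMod (p ^ (k + m)) // f (p ^ k : ℕ) = 0 })
      (n : ℤ)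
    rw [Int.cast_natCast] at this
    rw [this]
    simp [f₀]
  refine ⟨ZMod.lift (p ^ k) ⟨f₀, hf₀⟩, ?_, fun x => ⟨?_, ?_⟩⟩
  · rw [injective_iff_map_eq_zero]
    intro y hy
    rw [← ZMod.natCast_zmod_val y, hf, ZMod.natCast_eq_zero_iff, add_comm k m, pow_add] at hy
    rw [← ZMod.natCast_zmod_val y, ZMod.natCast_eq_zero_iff]
    exact Nat.dvd_of_mul_dvd_mul_left (pow_pos (Nat.pos_of_ne_zero hp) m) hy
  · rintro ⟨n, hn⟩
    exact ⟨n, by rw [hf, ← hn, ZMod.natCast_zmod_val]⟩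
  · rintro ⟨y, rfl⟩
    rw [← ZMod.natCast_zmod_val y, hf, ← ZMod.powReduction_eq_zero_iff p (Nat.le_add_left m k),
      map_natCast, ZMod.natCast_eq_zero_iff]
    exact dvd_mul_right _ _

/-! ### Recursion along a parent function -/

/-- The index drops from child to parent, so the recursion is well founded; roots receive the
default `b`. -/
theorem exists_recursion_along_parent {C : Type u} (parent : C → Option C) (index : C → ℕ)
    (hindex : ∀ c d, parent c = some d → index d < index c) {B : Type*} (b : B)
    (F : C → B → B) : ∃ H : C → B, ∀ c, H c = F c ((parent c).elim b H) := by
  let wf : WellFounded (fun c d : C => index c < index d) := InvImage.wf index wellFounded_lt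
  let step : (c : C) → (∀ d, index d < index c → B) → B := fun c rec =>
    F c (match hc : parent c with
      | none => b
      | some d => rec d (hindex c d hc))
  refine ⟨wf.fix step, fun c => ?_⟩
  rw [wf.fix_eq]
  simp only [step]
  congr 1
  split <;> rename_i h <;> simp [h]

/-- A forest whose nodes `c` stand for cyclic groups of order `p ^ len c`, the generator attached
to `c` being such that its multiple by `p ^ len c` is the generator attached to the parent of `c`
(or zero if there is none). Every node of level `β` has children of each level `α < β`
and of unbounded length. -/
structure ZippinForest (C : Type u) where
  level : C → Ordinal.{v}
  len : C → ℕ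
  depth : C → ℕ
  index : C → ℕ
  parent : C → Option C
  index_injective : Function.Injective index
  index_lt : ∀ {c d}, parent c = some d → index d < index c
  level_lt : ∀ {c d}, parent c = some d → level c < level d
  depth_eq : ∀ c, depth c = len c + (parent c).elim 0 depth
  exists_child : ∀ c γ n, γ < level c → ∃ d, parent d = some c ∧ level d = γ ∧ n ≤ len d

/-! ### The dual group of a forest and its filtration by level -/

namespace ZippinForest

variable {C : Type u} (F : ZippinForest.{u, v} C) (p : ℕ)

theorem depth_eq_add {c d : C} (h : F.parent c = some d) :
    F.depth c = F.len c + F.depth d := by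
  rw [F.depth_eq c, h]; rfl

theorem depth_le {c d : C} (h : F.parent c = some d) : F.depth d ≤ F.depth c := by
  rw [F.depth_eq_add h]; exact Nat.le_add_left _ _

/-- The families in `∏ c, ZMod (p ^ depth c)` which are compatible with reduction to the parent:
the Pontryagin dual of the abelian `p`-group simply presented by the forest. -/
def dual : AddSubgroup (∀ c, ZMod (p ^ F.depth c)) where
  carrier := {g | ∀ c d (h : F.parent c = some d),
    ZMod.powReduction p (F.depth_le h) (g c) = g d}
  zero_mem' := fun c d h => by simp
  add_mem' := fun ha hb c d h => by simp [ha c d h, hb c d h]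
  neg_mem' := fun ha c d h => by simp [ha c d h]

variable {F p} in
theorem reduction_apply (g : F.dual p) {c d : C} (h : F.parent c = some d) :
    ZMod.powReduction p (F.depth_le h) (g.1 c) = g.1 d := g.2 c d h

/-- The members of the dual which vanish at all nodes of level at least `α`. -/
def filtration (α : Ordinal.{v}) : AddSubgroup (F.dual p) where
  carrier := {g | ∀ c, α ≤ F.level c → g.1 c = 0}
  zero_mem' := fun c _ => rfl
  add_mem' := fun ha hb c h => by simp [ha c h, hb c h]
  neg_mem' := fun ha c h => by simp [ha c h]

variable {F p} in
theorem mem_filtration {α : Ordinal.{v}} {g : F.dual p} :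
    g ∈ F.filtration p α ↔ ∀ c, α ≤ F.level c → g.1 c = 0 := Iff.rfl

theorem filtration_mono {α β : Ordinal.{v}} (h : α ≤ β) :
    F.filtration p α ≤ F.filtration p β :=
  fun _ hg c hc => hg c (h.trans hc)

theorem continuous_apply (c : C) : Continuous fun g : F.dual p => g.1 c :=
  (_root_.continuous_apply c).comp continuous_subtype_val

theorem isClosed_dual : IsClosed (F.dual p : Set (∀ c, ZMod (p ^ F.depth c))) := by
  have : (F.dual p : Set (∀ c, ZMod (p ^ F.depth c))) = ⋂ (c) (d) (h : F.parent c = some d),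
      {g | ZMod.powReduction p (F.depth_le h) (g c) = g d} := by
    ext g
    simp only [Set.mem_iInter]
    rfl
  rw [this]
  refine isClosed_iInter fun c => isClosed_iInter fun d => isClosed_iInter fun h => ?_
  exact isClosed_eq (continuous_of_discreteTopology.comp (_root_.continuous_apply c))
    (_root_.continuous_apply d)

theorem isClosed_filtration (α : Ordinal.{v}) :
    IsClosed (F.filtration p α : Set (F.dual p)) := by
  have : (F.filtration p α : Set (F.dual p)) =
      ⋂ (c) (_ : α ≤ F.level c), {g | g.1 c = 0} := by
    ext g
    simp only [Set.mem_iInter]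
    rfl
  rw [this]
  exact isClosed_iInter fun c => isClosed_iInter fun _ =>
    isClosed_eq (F.continuous_apply p c) continuous_const

/-- Neighbourhoods in the dual contain all elements agreeing on finitely many nodes. -/
theorem exists_index_bound {U : Set (F.dual p)} (hU : IsOpen U) {g : F.dual p} (hg : g ∈ U) :
    ∃ M : ℕ, ∀ h : F.dual p, (∀ c, F.index c ≤ M → h.1 c = g.1 c) → h ∈ U := by
  obtain ⟨V, hV, rfl⟩ := isOpen_induced_iff.1 hU
  obtain ⟨I, w, hw, hIV⟩ := isOpen_pi_iff.1 hV g.1 hg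
  refine ⟨I.sup F.index, fun h hh => hIV fun c hc => ?_⟩
  rw [hh c (Finset.le_sup hc)]
  exact (hw c hc).2

theorem finite_index_le (M : ℕ) : {c | F.index c ≤ M}.Finite :=
  (Set.finite_Iic M).preimage F.index_injective.injOn

variable [Fact p.Prime]

instance : CompactSpace (F.dual p) :=
  isCompact_iff_compactSpace.1 (F.isClosed_dual p).isCompact

theorem isAbelianProP : IsAbelianProP p (F.dual p) where
  isTopologicalAddGroup := inferInstance
  compactSpace := inferInstance
  t2Space := inferInstance
  totallyDisconnectedSpace := inferInstance
  index_eq_pow := by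
    intro U hU
    obtain ⟨M, hM⟩ := F.exists_index_bound p hU (zero_mem U)
    have hfin : Finite (F.dual p ⧸ U) := AddSubgroup.quotient_finite_of_isOpen U hU
    have hpg : IsPGroup p (Multiplicative (F.dual p ⧸ U)) := by
      intro x
      refine ⟨(F.finite_index_le M).toFinset.sup F.depth, ?_⟩
      obtain ⟨y, rfl⟩ := Multiplicative.ofAdd.surjective x
      rw [← ofAdd_nsmul, ofAdd_eq_one]
      obtain ⟨g, rfl⟩ := QuotientAddGroup.mk_surjective y
      rw [← QuotientAddGroup.mk_nsmul, QuotientAddGroup.eq_zero_iff]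
      refine hM _ fun c hc => ?_
      have hle : F.depth c ≤ (F.finite_index_le M).toFinset.sup F.depth :=
        Finset.le_sup (f := F.depth) (by simpa using hc)
      have : ((p ^ (F.finite_index_le M).toFinset.sup F.depth : ℕ) : ZMod (p ^ F.depth c)) = 0 :=
        (ZMod.natCast_eq_zero_iff _ _).2 (pow_dvd_pow p hle)
      change (p ^ (F.finite_index_le M).toFinset.sup F.depth) • g.1 c = 0
      rw [nsmul_eq_mul, this, zero_mul]
    obtain ⟨n, hn⟩ := IsPGroup.iff_card.1 hpg
    exact ⟨n, hn⟩

/-- A compatible family on a set of nodes closed under parents extends to all nodes. -/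
theorem exists_extension (S : Set C) (hS : ∀ c d, F.parent c = some d → c ∈ S → d ∈ S)
    (x : ∀ c, ZMod (p ^ F.depth c))
    (hx : ∀ c ∈ S, ∀ d (h : F.parent c = some d),
      ZMod.powReduction p (F.depth_le h) (x c) = x d) :
    ∃ g : F.dual p, ∀ c ∈ S, g.1 c = x c := by
  classical
  -- The values are lifted to natural numbers: a node outside `S` copies its parent's number, so
  -- compatibility there is automatic.
  obtain ⟨H, hH⟩ := exists_recursion_along_parent F.parent F.index (fun _ _ => F.index_lt) 0
    (fun c b => if c ∈ S then (x c).val else b)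
  have hHS : ∀ c ∈ S, ((H c : ℕ) : ZMod (p ^ F.depth c)) = x c := by
    intro c hc
    rw [hH, if_pos hc, ZMod.natCast_zmod_val]
  refine ⟨⟨fun c => (H c : ℕ), fun c d h => ?_⟩, hHS⟩
  dsimp only
  by_cases hc : c ∈ S
  · rw [hHS c hc, hHS d (hS c d h hc), hx c hc d h]
  · rw [hH c, if_neg hc, h, map_natCast]
    rfl

/-- An element of the dual can be modified, outside a set `S` of nodes closed under parents, to
vanish at all nodes of level at least `β` outside `S`, if it vanishes at the nodes of `S` having a
child of level at least `β` outside `S`. -/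
theorem exists_truncation (g : F.dual p) (β : Ordinal.{v}) (S : Set C)
    (hS : ∀ c d, F.parent c = some d → c ∈ S → d ∈ S)
    (hg : ∀ c d, F.parent c = some d → β ≤ F.level c → d ∈ S → g.1 d = 0) :
    ∃ h : F.dual p, (∀ c ∈ S, h.1 c = g.1 c) ∧ ∀ c ∉ S, β ≤ F.level c → h.1 c = 0 := by
  classical
  -- Levels increase towards the root, so adjoining all nodes of level at least `β` keeps the set
  -- closed under parents.
  obtain ⟨h, hh⟩ := F.exists_extension p (S ∪ {c | β ≤ F.level c})
    (fun c d hcd hc => hc.imp (hS c d hcd) fun hc => le_trans hc (F.level_lt hcd).le)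
    (fun c => if c ∈ S then g.1 c else 0) (by
      rintro c hc d hcd
      by_cases hcS : c ∈ S
      · simp only [if_pos hcS, if_pos (hS c d hcd hcS), reduction_apply g hcd]
      · have hβ : β ≤ F.level c := hc.resolve_left hcS
        simp only [if_neg hcS, map_zero]
        split_ifs with hd
        · exact (hg c d hcd hβ hd).symm
        · rfl)
  exact ⟨h, fun c hc => by rw [hh c (Or.inl hc), if_pos hc],
    fun c hc hβ => by rw [hh c (Or.inr hβ), if_neg hc]⟩

theorem isParentClosed_index_le (M : ℕ) :
    ∀ c d, F.parent c = some d → c ∈ {c | F.index c ≤ M} → d ∈ {c | F.index c ≤ M} :=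
  fun _ _ h hc => (F.index_lt h).le.trans hc

/-- Elements of the next step are limits of elements that are torsion modulo the filtration. -/
theorem filtration_add_one_le_closure (α : Ordinal.{v}) {g : F.dual p}
    (hg : g ∈ F.filtration p (α + 1)) :
    g ∈ closure {h : F.dual p | ∃ n : ℕ, n ≠ 0 ∧ n • h ∈ F.filtration p α} := by
  rw [mem_closure_iff]
  intro U hU hgU
  obtain ⟨M, hM⟩ := F.exists_index_bound p hU hgU
  obtain ⟨h, hhS, hh0⟩ := F.exists_truncation p g α _ (F.isParentClosed_index_le M)
    (fun c d hcd hc _ => hg d (Order.add_one_le_of_lt (hc.trans_lt (F.level_lt hcd))))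
  refine ⟨h, hM h hhS, p ^ (F.finite_index_le M).toFinset.sup F.depth,
    pow_ne_zero _ (Fact.out : p.Prime).ne_zero, fun c hc => ?_⟩
  change (p ^ (F.finite_index_le M).toFinset.sup F.depth) • h.1 c = 0
  by_cases hcM : F.index c ≤ M
  · have hle : F.depth c ≤ (F.finite_index_le M).toFinset.sup F.depth :=
      Finset.le_sup (f := F.depth) (by simpa using hcM)
    rw [nsmul_eq_mul, (ZMod.natCast_eq_zero_iff _ _).2 (pow_dvd_pow p hle), zero_mul]
  · rw [hh0 c hcM hc, smul_zero]

/-- Elements that are torsion modulo the filtration lie in the next step. -/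
theorem mem_filtration_add_one {α : Ordinal.{v}} {h : F.dual p} {n : ℕ} (hn : n ≠ 0)
    (hh : n • h ∈ F.filtration p α) : h ∈ F.filtration p (α + 1) := by
  have hp : p.Prime := Fact.out
  intro c hc
  -- Length `n` suffices: if `p ^ m` is the `p`-part of `n`, then `m ≤ n ≤ len d`, so cancelling it
  -- still leaves `p ^ depth c` dividing the value at `d`.
  obtain ⟨d, hdc, hdα, hlen⟩ := F.exists_child c α n (Order.add_one_le_iff.1 hc)
  have h0 : n • h.1 d = 0 := hh d hdα.ge
  rw [nsmul_eq_mul, ← ZMod.natCast_zmod_val (h.1 d), ← Nat.cast_mul,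
    ZMod.natCast_eq_zero_iff] at h0
  rw [← reduction_apply h hdc, ZMod.powReduction_eq_zero_iff]
  obtain ⟨m, u, hu, hnu⟩ := Nat.exists_eq_pow_mul_and_not_dvd hn p hp.ne_one
  have hmn : m ≤ n :=
    ((Nat.lt_pow_self hp.one_lt).trans_le
      (Nat.le_of_dvd (Nat.pos_of_ne_zero hn) ⟨u, hnu⟩)).le
  have hdvd : p ^ (m + F.depth c) ∣ n * (h.1 d).val :=
    (pow_dvd_pow p (by have := F.depth_eq_add hdc; omega)).trans h0
  generalize (h.1 d).val = v at hdvd ⊢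
  rw [hnu, pow_add, mul_assoc] at hdvd
  exact hp.prime.pow_dvd_of_dvd_mul_left _ hu (Nat.dvd_of_mul_dvd_mul_left (pow_pos hp.pos m) hdvd)

end ZippinForest

/-! ### The torsion series of the dual and its factors -/

namespace ZippinForest

variable {C : Type u} (F : ZippinForest.{u, v} C) (p : ℕ) [Fact p.Prime]

omit [Fact p.Prime] in
theorem filtration_zero : F.filtration p 0 = ⊥ := by
  rw [eq_bot_iff]
  intro g hg
  rw [AddSubgroup.mem_bot]
  exact Subtype.ext (funext fun c => hg c (bot_le))

omit [Fact p.Prime] in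
theorem filtration_eq_top {α : Ordinal.{v}} (h : ∀ c, F.level c < α) :
    F.filtration p α = ⊤ :=
  eq_top_iff.2 fun _ _ c hc => absurd hc (not_le.2 (h c))

theorem comap_closedTorsion_filtration (α : Ordinal.{v}) :
    (closedTorsion (F.dual p ⧸ F.filtration p α)).comap
      (QuotientAddGroup.mk' (F.filtration p α)) = F.filtration p (α + 1) := by
  set T := F.filtration p α
  have hle : T ≤ F.filtration p (α + 1) := F.filtration_mono p (le_add_of_nonneg_right (bot_le))
  have hcomap : ((F.filtration p (α + 1)).map (QuotientAddGroup.mk' T)).comap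
      (QuotientAddGroup.mk' T) = F.filtration p (α + 1) := by
    rw [AddSubgroup.comap_map_eq, QuotientAddGroup.ker_mk', sup_eq_left.2 hle]
  apply le_antisymm
  · rw [← hcomap]
    refine AddSubgroup.comap_mono (AddSubgroup.topologicalClosure_minimal _ ?_ ?_)
    · intro y hy
      obtain ⟨h, rfl⟩ := QuotientAddGroup.mk_surjective y
      obtain ⟨n, hn, hnh⟩ := isOfFinAddOrder_iff_nsmul_eq_zero.1 hy
      rw [← QuotientAddGroup.mk_nsmul, QuotientAddGroup.eq_zero_iff] at hnh
      exact ⟨h, F.mem_filtration_add_one p hn.ne' hnh, rfl⟩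
    · rw [← (QuotientAddGroup.isQuotientMap_mk (N := T)).isClosed_preimage]
      have := F.isClosed_filtration p (α + 1)
      rw [← hcomap] at this
      exact this
  · intro g hg
    refine map_mem_closure (QuotientAddGroup.continuous_mk (N := T))
      (F.filtration_add_one_le_closure p α hg) ?_
    rintro h ⟨n, hn, hnh⟩
    refine isOfFinAddOrder_iff_nsmul_eq_zero.2 ⟨n, Nat.pos_of_ne_zero hn, ?_⟩
    rw [← map_nsmul]
    exact (QuotientAddGroup.eq_zero_iff _).2 hnh

/-- A neighbourhood sees finitely many nodes, and their levels below `δ` are bounded by some `β <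
δ`; truncating at `β` stays in the neighbourhood. -/
theorem filtration_limit {δ : Ordinal.{v}} (hδ : Order.IsSuccLimit δ) :
    F.filtration p δ =
      (⨆ (β : Ordinal.{v}) (_ : β < δ), F.filtration p β).topologicalClosure := by
  apply le_antisymm
  · intro g hg
    refine mem_closure_iff.2 fun U hU hgU => ?_
    obtain ⟨M, hM⟩ := F.exists_index_bound p hU hgU
    classical
    obtain ⟨β, hβδ, hβ⟩ : ∃ β < δ, ∀ c, F.index c ≤ M → F.level c < δ → F.level c < β := by
      refine ⟨((F.finite_index_le M).toFinset.filter fun c => F.level c < δ).sup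
        fun c => Order.succ (F.level c), ?_, fun c hc hcδ => ?_⟩
      · rw [Finset.sup_lt_iff hδ.bot_lt]
        intro c hc
        exact hδ.succ_lt (Finset.mem_filter.1 hc).2
      · exact (Order.lt_succ _).trans_le (Finset.le_sup
          (f := fun c => Order.succ (F.level c)) (by simpa using ⟨hc, hcδ⟩))
    have hvanish : ∀ c, F.index c ≤ M → β ≤ F.level c → g.1 c = 0 := fun c hc hcβ =>
      hg c (not_lt.1 fun hlt => absurd (hβ c hc hlt) (not_lt.2 hcβ))
    obtain ⟨h, hhS, hh0⟩ := F.exists_truncation p g β _ (F.isParentClosed_index_le M)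
      (fun c d hcd hc hd => hvanish d hd (hc.trans (F.level_lt hcd).le))
    refine ⟨h, hM h hhS, AddSubgroup.mem_iSup_of_mem β
      (AddSubgroup.mem_iSup_of_mem hβδ fun c hc => ?_)⟩
    by_cases hcM : F.index c ≤ M
    · rw [hhS c hcM, hvanish c hcM hc]
    · exact hh0 c hcM hc
  · exact AddSubgroup.topologicalClosure_minimal _
      (iSup₂_le fun β hβ => F.filtration_mono p hβ.le) (F.isClosed_filtration p δ)

theorem torsionSeries_dual (α : Ordinal.{v}) :
    torsionSeries (F.dual p) α = F.filtration p α := by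
  induction α using Ordinal.limitRecOn with
  | zero => rw [torsionSeries_zero, filtration_zero]
  | add_one α ih => rw [torsionSeries_add_one, ih, comap_closedTorsion_filtration]
  | limit δ hδ ih =>
    rw [torsionSeries_limit _ _ hδ, F.filtration_limit p hδ]
    congr 1
    exact iSup_congr fun β => iSup_congr fun hβ => ih β hβ

/-- The kernel of a torsion-free quotient absorbs torsion modulo any subgroup it contains; being
closed, it absorbs every term of the filtration, the last of which is the whole group. -/
theorem isDualReduced {τ : Ordinal.{v}} (hτ : ∀ c, F.level c < τ) : IsDualReduced (F.dual p) := by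
  intro H hH htf
  have hle : ∀ α : Ordinal.{v}, F.filtration p α ≤ H := by
    intro α
    induction α using Ordinal.limitRecOn with
    | zero => rw [filtration_zero]; exact bot_le
    | add_one α ih =>
      intro g hg
      refine closure_minimal ?_ hH (F.filtration_add_one_le_closure p α hg)
      rintro h ⟨n, hn, hnh⟩
      rw [SetLike.mem_coe, ← QuotientAddGroup.eq_zero_iff]
      refine IsAddTorsionFree.nsmul_right_injective hn ?_
      simp only [smul_zero]
      rw [← QuotientAddGroup.mk_nsmul]
      exact (QuotientAddGroup.eq_zero_iff _).2 (ih hnh)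
    | limit δ hδ ih =>
      rw [F.filtration_limit p hδ]
      exact AddSubgroup.topologicalClosure_minimal _ (iSup₂_le ih) hH
  have htop : H = ⊤ := top_le_iff.1 (F.filtration_eq_top p hτ ▸ hle τ)
  exact htop ▸ QuotientAddGroup.subsingleton_quotient_top

/-- A factor of the torsion series, in coordinates. -/
theorem exists_torsionFactor_embedding (α : Ordinal.{v}) :
    ∃ f : TorsionFactor (F.dual p) α →+ ∀ c : {c // F.level c = α}, ZMod (p ^ F.depth c),
      Continuous f ∧ Function.Injective f ∧
        ∀ x, (∃ y, f y = x) ↔ ∀ c : {c // F.level c = α},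
          p ^ (F.depth c - F.len c) ∣ (x c).val := by
  let r : torsionSeries (F.dual p) (α + 1) →+
      ∀ c : {c // F.level c = α}, ZMod (p ^ F.depth c) :=
    { toFun := fun g c => g.1.1 c
      map_zero' := rfl
      map_add' := fun _ _ => rfl }
  have hr : Continuous r := continuous_pi fun c =>
    (F.continuous_apply p c).comp continuous_subtype_val
  have hker : r.ker = (torsionSeries (F.dual p) α).addSubgroupOf
      (torsionSeries (F.dual p) (α + 1)) := by
    ext g
    have hg : g.1 ∈ F.filtration p (α + 1) := F.torsionSeries_dual p (α + 1) ▸ g.2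
    rw [AddSubgroup.mem_addSubgroupOf, torsionSeries_dual p (F := F) (α := α),
      AddMonoidHom.mem_ker]
    refine ⟨fun h c hc => ?_, fun h => funext fun c => h c c.2.ge⟩
    rcases hc.eq_or_lt with hc | hc
    · exact congrFun h ⟨c, hc.symm⟩
    · exact hg c (Order.add_one_le_of_lt hc)
  refine ⟨QuotientAddGroup.lift _ r hker.ge, hr.quotient_lift _, ?_, fun x => ⟨?_, fun hx => ?_⟩⟩
  · rw [injective_iff_map_eq_zero]
    intro y hy
    obtain ⟨g, rfl⟩ := QuotientAddGroup.mk_surjective y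
    exact (QuotientAddGroup.eq_zero_iff _).2 (hker.le hy)
  · rintro ⟨y, rfl⟩ ⟨c, hc⟩
    obtain ⟨g, rfl⟩ := QuotientAddGroup.mk_surjective y
    change _ ∣ (g.1.1 c).val
    have hg : g.1 ∈ F.filtration p (α + 1) := F.torsionSeries_dual p (α + 1) ▸ g.2
    cases h : F.parent c with
    | none => simp [F.depth_eq c, h]
    | some d =>
      -- Divisibility by `p ^ depth d` says that the reduction to the parent vanishes, as it must
      -- since the parent has level above `α`.
      rw [show F.depth c - F.len c = F.depth d by rw [F.depth_eq_add h, Nat.add_sub_cancel_left],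
        ← ZMod.powReduction_eq_zero_iff p (F.depth_le h), reduction_apply g.1 h]
      exact hg d (Order.add_one_le_of_lt (hc ▸ F.level_lt h))
  · classical
    obtain ⟨g, hg⟩ := F.exists_extension p {c | α ≤ F.level c}
      (fun c d hcd hc => le_trans hc (F.level_lt hcd).le)
      (fun c => if h : F.level c = α then x ⟨c, h⟩ else 0) (by
        intro c hc d hcd
        have hd : F.level d ≠ α := (lt_of_le_of_lt hc (F.level_lt hcd)).ne'
        simp only [dif_neg hd]
        split_ifs with h
        · rw [ZMod.powReduction_eq_zero_iff]
          have := hx ⟨c, h⟩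
          rwa [show F.depth c - F.len c = F.depth d by
            rw [F.depth_eq_add hcd, Nat.add_sub_cancel_left]] at this
        · exact map_zero _)
    have hgmem : g ∈ torsionSeries (F.dual p) (α + 1) := by
      rw [torsionSeries_dual]
      intro c hc
      have hlt : α < F.level c := Order.add_one_le_iff.1 hc
      rw [hg c hlt.le, dif_neg hlt.ne']
    refine ⟨QuotientAddGroup.mk ⟨g, hgmem⟩, funext fun c => ?_⟩
    change g.1 c = _
    rw [hg c c.2.ge, dif_pos c.2]

instance (α : Ordinal.{v}) : CompactSpace (TorsionFactor (F.dual p) α) := by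
  have : CompactSpace (torsionSeries (F.dual p) (α + 1)) := by
    rw [torsionSeries_dual]
    exact isCompact_iff_compactSpace.1 (F.isClosed_filtration p (α + 1)).isCompact
  infer_instance

end ZippinForest

/-! ### Comparison with Cartesian groups -/

/-- Compact groups embedded continuously with the same image in a Hausdorff group are
isomorphic. -/
theorem nonempty_continuousAddEquiv_of_range_eq {A : Type*} {B : Type*} {E : Type*}
    [AddCommGroup A] [TopologicalSpace A] [CompactSpace A]
    [AddCommGroup B] [TopologicalSpace B] [CompactSpace B]
    [AddCommGroup E] [TopologicalSpace E] [T2Space E]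
    (f : A →+ E) (hf : Continuous f) (hfi : Function.Injective f)
    (g : B →+ E) (hg : Continuous g) (hgi : Function.Injective g)
    (h : ∀ x, (∃ a, f a = x) ↔ ∃ b, g b = x) : Nonempty (A ≃ₜ+ B) := by
  have hfe := hf.isClosedEmbedding hfi
  have hge := hg.isClosedEmbedding hgi
  let e : A ≃+ B := (AddMonoidHom.ofInjective hfi).trans
    ((AddEquiv.addSubgroupCongr (AddSubgroup.ext h)).trans (AddMonoidHom.ofInjective hgi).symm)
  have he : ∀ a, g (e a) = f a := fun a =>
    congrArg Subtype.val ((AddMonoidHom.ofInjective hgi).apply_symm_apply _)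
  have he' : ∀ b, f (e.symm b) = g b := fun b => by rw [← he, e.apply_symm_apply]
  refine ⟨{ e with continuous_toFun := ?_, continuous_invFun := ?_ }⟩
  · exact hge.isInducing.continuous_iff.2 (hf.congr fun a => (he a).symm)
  · exact hfe.isInducing.continuous_iff.2 (hg.congr fun b => (he' b).symm)

/-- A Cartesian group in the coordinates used for the factors of the torsion series. -/
theorem exists_cartesian_embedding (p : ℕ) [Fact p.Prime] {ι : Type*} (k : ι → ℕ)
    {J : Type*} (b : J ≃ {i // 0 < k i}) (D m : J → ℕ) (hD : ∀ c, D c = k (b c) + m c) :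
    ∃ f : (∀ i, ZMod (p ^ k i)) →+ ∀ c : J, ZMod (p ^ D c),
      Continuous f ∧ Function.Injective f ∧
        ∀ x, (∃ y, f y = x) ↔ ∀ c, p ^ m c ∣ (x c).val := by
  choose μ hμ hrange using fun c => ZMod.exists_pow_embedding p (hD c)
  refine ⟨{ toFun := fun y c => μ c (y (b c)), map_zero' := ?_, map_add' := ?_ }, ?_, ?_, ?_⟩
  · ext; simp
  · intros; ext; simp
  · exact continuous_pi fun c => continuous_of_discreteTopology.comp (continuous_apply _)
  · intro y z hyz
    funext i
    by_cases hi : 0 < k i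
    · have := hμ (b.symm ⟨i, hi⟩) (congrFun hyz (b.symm ⟨i, hi⟩))
      rwa [b.apply_symm_apply] at this
    · have hk : p ^ k i = 1 := by rw [Nat.eq_zero_of_not_pos hi, pow_zero]
      have : Subsingleton (ZMod (p ^ k i)) := by rw [hk]; infer_instance
      exact Subsingleton.elim _ _
  · intro x
    constructor
    · rintro ⟨y, rfl⟩ c
      exact (hrange c _).2 ⟨_, rfl⟩
    · intro hx
      choose y hy using fun c => (hrange c (x c)).1 (hx c)
      -- `HEq` transports `y c` along `b c = i`; indices with `k i = 0` come from no `c` and get the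
      -- value `0`.
      have hz : ∀ i, ∃ z : ZMod (p ^ k i), ∀ c, (b c : ι) = i → HEq z (y c) := by
        intro i
        by_cases h : ∃ c, (b c : ι) = i
        · obtain ⟨c, rfl⟩ := h
          refine ⟨y c, fun c' hc' => ?_⟩
          rw [b.injective (Subtype.ext hc')]
        · exact ⟨0, fun c hc => absurd ⟨c, hc⟩ h⟩
      choose z hz using hz
      refine ⟨z, funext fun c => ?_⟩
      change μ c (z (b c)) = x c
      rw [eq_of_heq (hz (b c) c rfl), hy]

/-! ### Existence of forests -/

/-- Countably many infinite sets have an injective choice function. -/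
theorem exists_injective_choice {D : Type*} [Countable D] {C : Type*} (A : D → Set C)
    (hA : ∀ q, (A q).Infinite) : ∃ s : D → C, Function.Injective s ∧ ∀ q, s q ∈ A q := by
  classical
  obtain ⟨enc, henc⟩ := exists_injective_nat D
  -- Sizes `enc q + 1` give Hall's condition: a finite set of demands has at most as many members as
  -- the candidate set of its member with largest code.
  choose t htA ht using fun q => (hA q).exists_subset_card_eq (enc q + 1)
  obtain ⟨s, hs, hst⟩ := (Finset.all_card_le_biUnion_card_iff_exists_injective t).1 (by
    intro S
    rcases S.eq_empty_or_nonempty with rfl | hS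
    · simp
    obtain ⟨q, hq, hmax⟩ := S.exists_max_image enc hS
    calc S.card = (S.image enc).card := (Finset.card_image_of_injective _ henc).symm
      _ ≤ (Finset.range (enc q + 1)).card := Finset.card_le_card (by
          intro n hn
          obtain ⟨r, hr, rfl⟩ := Finset.mem_image.1 hn
          exact Finset.mem_range.2 (Nat.lt_succ_of_le (hmax r hr)))
      _ = (t q).card := by rw [Finset.card_range, ht]
      _ ≤ (S.biUnion t).card := Finset.card_le_card (Finset.subset_biUnion_of_mem t hq))
  exact ⟨s, hs, fun q => htA q (hst q)⟩

/-- A triple `(c, γ, n)` is a demand for a child of `c`. Distinct demands receive distinct nodes, so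
parents are well defined, and unused nodes become roots. -/
theorem exists_zippinForest {C : Type u} [Countable C] (level : C → Ordinal.{v}) (len : C → ℕ)
    (hcount : ∀ c, Countable (Set.Iio (level c)))
    (hinf : ∀ c, ∀ γ < level c, ∀ n, {d | level d = γ ∧ n ≤ len d}.Infinite) :
    ∃ F : ZippinForest.{u, v} C, F.level = level ∧ F.len = len := by
  classical
  obtain ⟨index, hindex⟩ := exists_injective_nat C
  obtain ⟨s, hs, hsA⟩ := exists_injective_choice
    (fun q : (Σ c : C, Set.Iio (level c) × ℕ) =>
      {d | level d = q.2.1 ∧ q.2.2 ≤ len d} \ {d | index d ≤ index q.1})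
    (fun q => (hinf q.1 q.2.1 q.2.1.2 q.2.2).sdiff
      -- Discarding the finitely many nodes of index at most that of `c` makes the index increase
      -- from parent to child.
      ((Set.finite_Iic (index q.1)).preimage hindex.injOn))
  let parent : C → Option C := fun d =>
    if h : ∃ q, s q = d then some h.choose.1 else none
  have hparent : ∀ d c, parent d = some c → ∃ q, s q = d ∧ q.1 = c := by
    intro d c hdc
    by_cases h : ∃ q, s q = d
    · simp only [parent, dif_pos h, Option.some.injEq] at hdc
      exact ⟨h.choose, h.choose_spec, hdc⟩
    · simp only [parent, dif_neg h, reduceCtorEq] at hdc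
  have hparent' : ∀ q, parent (s q) = some q.1 := by
    intro q
    have h : ∃ q', s q' = s q := ⟨q, rfl⟩
    simp only [parent, dif_pos h]
    rw [hs h.choose_spec]
  have hlt : ∀ c d, parent c = some d → index d < index c := by
    intro c d h
    obtain ⟨q, rfl, rfl⟩ := hparent c d h
    exact not_le.1 (hsA q).2
  obtain ⟨depth, hdepth⟩ := exists_recursion_along_parent parent index hlt 0
    (fun c b => len c + b)
  refine ⟨{ level := level, len := len, depth := depth, index := index, parent := parent,
            index_injective := hindex, index_lt := fun h => hlt _ _ h,
            level_lt := ?_, depth_eq := hdepth, exists_child := ?_ }, rfl, rfl⟩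
  · intro c d h
    obtain ⟨q, rfl, rfl⟩ := hparent c d h
    rw [(hsA q).1.1]
    exact q.2.1.2
  · intro c γ n hγ
    have h := hsA ⟨c, ⟨γ, hγ⟩, n⟩
    exact ⟨s ⟨c, ⟨γ, hγ⟩, n⟩, hparent' _, h.1.1, h.1.2⟩

/-! ### Countability and unboundedness of the cyclic factors -/

/-- Each basic neighbourhood of zero restricts finitely many coordinates; a non-trivial coordinate
restricted by none of them could not have an open kernel. -/
theorem countable_pos_of_firstCountable (p : ℕ) [Fact p.Prime] {ι : Type*} (k : ι → ℕ)
    [FirstCountableTopology (∀ i, ZMod (p ^ k i))] : Countable {i // 0 < k i} := by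
  obtain ⟨U, hU⟩ := (𝓝 (0 : ∀ i, ZMod (p ^ k i))).exists_antitone_basis
  have hI : ∀ n, ∃ I : Set ι, I.Finite ∧ ∀ x : ∀ i, ZMod (p ^ k i),
      (∀ i ∈ I, x i = 0) → x ∈ U n := by
    intro n
    have := hU.mem n
    rw [nhds_pi, Filter.mem_pi] at this
    obtain ⟨I, hI, t, ht, hsub⟩ := this
    exact ⟨I, hI, fun x hx => hsub fun i hi => by rw [hx i hi]; exact mem_of_mem_nhds (ht i)⟩
  choose I hIfin hI using hI
  refine Set.Countable.mono (s₂ := ⋃ n, I n) (fun i hi => ?_)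
    (Set.countable_iUnion fun n => (hIfin n).countable) |>.to_subtype
  have hnhds : (fun x : ∀ i, ZMod (p ^ k i) => x i) ⁻¹' {0} ∈ 𝓝 0 :=
    ((isOpen_discrete {(0 : ZMod (p ^ k i))}).preimage (continuous_apply i)).mem_nhds
      (Set.mem_singleton 0)
  obtain ⟨n, hn⟩ := hU.mem_iff.1 hnhds
  rw [Set.mem_iUnion]
  refine ⟨n, by_contra fun hin => ?_⟩
  classical
  have : Fact (1 < p ^ k i) := ⟨Nat.one_lt_pow (Nat.pos_iff_ne_zero.1 hi) (Fact.out : p.Prime).one_lt⟩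
  have hmem := hn (hI n (Pi.single i 1) fun j hj => by
    rw [Pi.single_eq_of_ne]; rintro rfl; exact hin hj)
  rw [Set.mem_preimage, Pi.single_eq_same] at hmem
  exact one_ne_zero hmem

theorem infinite_le_of_not_exponentExists (p : ℕ) [Fact p.Prime] {ι : Type*} (k : ι → ℕ)
    (h : ¬ AddMonoid.ExponentExists (∀ i, ZMod (p ^ k i))) (n : ℕ) : {i | n ≤ k i}.Infinite := by
  intro hfin
  refine h ⟨p ^ max n (hfin.toFinset.sup k), pow_pos (Fact.out : p.Prime).pos _, fun x => ?_⟩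
  funext i
  have hle : k i ≤ max n (hfin.toFinset.sup k) := by
    by_cases hi : n ≤ k i
    · exact le_max_of_le_right (Finset.le_sup (f := k) (by simpa using hi))
    · exact le_max_of_le_left (not_le.1 hi).le
  rw [Pi.smul_apply, nsmul_eq_mul, (ZMod.natCast_eq_zero_iff _ _).2 (pow_dvd_pow p hle), zero_mul]
  rfl

/-! ### The realisation theorem -/

theorem theorem2p4 (p : ℕ) [Fact p.Prime] (τ : Ordinal.{v}) (hτ : τ.card ≤ Cardinal.aleph0)
    (N : Set.Iio τ → Type u) [∀ α, AddCommGroup (N α)] [∀ α, TopologicalSpace (N α)]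
    (hN : ∀ α, IsCartesian p (N α))
    (hcount : ∀ α, FirstCountableTopology (N α))
    (hnontriv : ∀ α, Nontrivial (N α))
    (hunb : ∀ α : Set.Iio τ, α.1 + 1 < τ → ¬ AddMonoid.ExponentExists (N α)) :
    ∃ (G : Type u) (_ : AddCommGroup G) (_ : TopologicalSpace G) (_ : IsTopologicalAddGroup G),
      IsAbelianProP p G ∧ IsDualReduced G ∧ HasTorsionSequence G τ N := by
  choose ι k e using hN
  replace e := fun α => (e α).some
  have hιcount : ∀ α, Countable {i // 0 < k α i} := fun α => by
    have := (e α).symm.toHomeomorph.isInducing.firstCountableTopology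
    exact countable_pos_of_firstCountable p (k α)
  have hτcount : Countable (Set.Iio τ) := by
    rw [← Cardinal.mk_le_aleph0_iff, Cardinal.mk_Iio_ordinal]
    rwa [Cardinal.lift_le_aleph0]
  have hlt : ∀ α : Set.Iio τ, ∀ γ < α.1, γ + 1 < τ := fun α γ hγ =>
    (Order.add_one_le_of_lt hγ).trans_lt α.2
  -- Trivial factors are dropped, as there may be uncountably many; countability of the rest lets
  -- the nodes live in universe `u`.
  let C := Shrink.{u} (Σ α : Set.Iio τ, {i // 0 < k α i})
  let s : C ≃ Σ α : Set.Iio τ, {i // 0 < k α i} := (equivShrink _).symm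
  have : Countable C := s.countable_iff.2 inferInstance
  obtain ⟨F, hlevel, hlen⟩ := exists_zippinForest (fun c => (s c).1.1)
    (fun c => k (s c).1 (s c).2)
    (fun c => (Set.Countable.mono (Set.Iio_subset_Iio (s c).1.2.le)
      (Set.to_countable (Set.Iio τ))).to_subtype)
    (by
      intro c γ hγ n
      have hγτ : γ < τ := lt_trans hγ (s c).1.2
      have hinf := infinite_le_of_not_exponentExists p (k ⟨γ, hγτ⟩) (fun ⟨m, hm, h⟩ =>
        hunb ⟨γ, hγτ⟩ (hlt _ _ hγ) ⟨m, hm, fun x => (e ⟨γ, hγτ⟩).injective (by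
          rw [map_nsmul, map_zero]; exact h _)⟩) (n + 1)
      have := hinf.to_subtype
      -- The bound `n + 1` rather than `n` ensures positive length, so these factors are nodes even
      -- when `n = 0`.
      refine Set.infinite_of_injective_forall_mem
        (f := fun i : {i | n + 1 ≤ k ⟨γ, hγτ⟩ i} =>
          s.symm ⟨⟨γ, hγτ⟩, i.1, (Nat.succ_pos n).trans_le i.2⟩) ?_ ?_
      · intro i j hij
        have := s.symm.injective hij
        simpa [Subtype.ext_iff] using this
      · intro i
        rw [Set.mem_ofPred_eq, s.apply_symm_apply]
        exact ⟨rfl, (Nat.le_succ n).trans i.2⟩)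
  have hfactor : ∀ α : Set.Iio τ, Nonempty (TorsionFactor (F.dual p) α.1 ≃ₜ+ N α) := by
    intro α
    obtain ⟨f, hf, hfi, hfr⟩ := F.exists_torsionFactor_embedding p α.1
    let b : {i // 0 < k α i} ≃ {c // F.level c = α.1} := Equiv.ofBijective
      (fun i => ⟨s.symm ⟨α, i⟩, by simp [hlevel]⟩) (by
        constructor
        · intro i j hij
          simpa using hij
        · rintro ⟨c, hc⟩
          obtain ⟨⟨β, i⟩, rfl⟩ := s.symm.surjective c
          have hβ : (s (s.symm ⟨β, i⟩)).1.1 = α.1 := by rw [← hc, hlevel]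
          rw [s.apply_symm_apply] at hβ
          obtain rfl : β = α := Subtype.ext hβ
          exact ⟨i, rfl⟩)
    obtain ⟨g, hg, hgi, hgr⟩ := exists_cartesian_embedding p (k α) b.symm
      (fun c => F.depth c) (fun c => F.depth c - F.len c) (by
        intro c
        obtain ⟨i, rfl⟩ := b.surjective c
        have hl : F.len (b i) = k α i := by
          rw [hlen]
          change k (s (s.symm ⟨α, i⟩)).1 (s (s.symm ⟨α, i⟩)).2 = _
          rw [s.apply_symm_apply]
        rw [b.symm_apply_apply, ← hl, Nat.add_sub_cancel']
        rw [F.depth_eq]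
        exact Nat.le_add_right _ _)
    obtain ⟨e'⟩ := nonempty_continuousAddEquiv_of_range_eq f hf hfi g hg hgi
      (fun x => (hfr x).trans (hgr x).symm)
    exact ⟨e'.trans (e α).symm⟩
  have hlevelτ : ∀ c, F.level c < τ := fun c => by rw [hlevel]; exact (s c).1.2
  refine ⟨F.dual p, inferInstance, inferInstance, inferInstance, F.isAbelianProP p,
    F.isDualReduced p hlevelτ, ⟨?_, fun σ hσ => ?_⟩, hfactor⟩
  · change torsionSeries _ τ = torsionSeries _ (τ + 1)
    rw [F.torsionSeries_dual, F.torsionSeries_dual, F.filtration_eq_top p hlevelτ,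
      F.filtration_eq_top p fun c => (hlevelτ c).trans (Order.lt_add_one_iff.2 le_rfl)]
  -- Stopping at `σ < τ` would make the factor at `σ` trivial, against the non-triviality of `N σ`.
  · by_contra hlt
    obtain ⟨e'⟩ := hfactor ⟨σ, not_le.1 hlt⟩
    have hnt := hnontriv ⟨σ, not_le.1 hlt⟩
    have hle : torsionSeries (F.dual p) (σ + 1) ≤ torsionSeries (F.dual p) σ := hσ.ge
    have : Subsingleton (TorsionFactor (F.dual p) σ) := by
      rw [TorsionFactor, AddSubgroup.addSubgroupOf_eq_top.2 hle]
      exact QuotientAddGroup.subsingleton_quotient_top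
    exact not_subsingleton _ e'.symm.toEquiv.subsingleton
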